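/- **Setting.** Let $d\in\mathbb N$, $n_1,\dots,n_d\in\mathbb N$, let $\mathcal L:\mathbb R^{n_1\times\cdots\times n_d}\to\mathbb R^\ell$ be linear and surjective with $\ell<n_1\cdots n_d$, let $y\in\mathbb R^\ell$, and let $\mathcal K$ be a nonempty set of subsets $J$ of $[d]=\{1,\dots,d\}$ with $\emptyset\ne J\ne[d]$. For such $J$ put $J^{c}=[d]\setminus J$, $n_J=\prod_{\mu\in J}n_\mu$, and let $X^{[J]}\in\mathbb R^{n_J\times n_{J^c}}$ be the matricization of the tensor $X$ whose rows are indexed by the modes in $J$ and whose columns are indexed by the modes in $J^c$. For a finite family $\mathcal F$ of such sets (counted with multiplicity), $\gamma>0$ and symmetric positive definite $W=\{W^{(J)}\}_{J\in\mathcal F}$, let $$f^{\mathcal F}_\gamma(X)=\sum_{J\in\mathcal F}\log\det\big(X^{[J]}(X^{[J]})^T+\gamma I\big),$$ $$J^{\mathcal F}_\gamma(X,W)=\sum_{J\in\mathcal F}\Big(\operatorname{trace}\big(W^{(J)}(X^{[J]}(X^{[J]})^T+\gamma I)\big)-\log\det W^{(J)}-n_J\Big),$$ $$W^{(J)}_{\gamma,X}=\big(X^{[J]}(X^{[J]})^T+\gamma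 I\big)^{-1}.$$ For $\mathcal S\subseteq\mathcal K$ let $\mathcal K^{\mathcal S}$ be the family obtained from $\mathcal K$ by replacing each $J\in\mathcal S$ by $J^c$ (with multiplicity, should $\mathcal K$ contain both a set and its complement). Let $(\gamma^{(i)})_{i\ge0}$ be a weakly decreasing sequence of positive reals with limit $\gamma^\ast$, let $\mathcal S_i\subseteq\mathcal K$ for $i\ge 0$, let $X^{(0)}\in\mathcal L^{-1}(y)$, and for $i\ge1$ let $$X^{(i)}=\operatorname*{argmin}_{X\in\mathcal L^{-1}(y)}J^{\mathcal K^{\mathcal S_{i-1}}}_{\gamma^{(i-1)}}(X,W),\qquad W^{(J)}=W^{(J)}_{\gamma^{(i-1)},X^{(i-1)}}.$$ For $\gamma>0$ let $\mathcal S^\ast_\gamma\subset\mathcal L^{-1}(y)$ be the set of stationary points of $f^{\mathcal K}_\gamma$ restricted to the affine space $\mathcal L^{-1}(y)$. Norms of tensors are Frobenius norms. **Theorem.** (i) For each $i\ge1$ and each $\mathcal S\subseteq\mathcal K$, $f^{\mathcal K^{\mathcal S}}_{\gamma^{(i)}}(X^{(i)})\le f^{\mathcal K^{\mathcal S}}_{\gamma^{(i-1)}}(X^{(i-1)})$.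 (ii) If $\gamma^\ast>0$, then the sequence $X^{(i)}$ and, for each $\mathcal S\subseteq\mathcal K$, the sequence $|f^{\mathcal K^{\mathcal S}}_{\gamma^{(i)}}(X^{(i)})|$ are bounded. (iii) If $\gamma^\ast>0$, then $\lim_{i\to\infty}\|X^{(i)}-X^{(i-1)}\|_F=0$, and each accumulation point of $(X^{(i)})$ lies in $\mathcal S^\ast_{\gamma^\ast}$. (iv) Let $\Theta\subset\mathbb R_{>0}$ be an infinite, bounded set whose only accumulation point is $\inf\Theta=0$, let $(\alpha_i)_{i\ge0}$ be a bounded real sequence with $\inf_i\alpha_i>0$, and let $\delta_i=\inf_{S\in\mathcal S^\ast_{\gamma^{(i)}}}\|X^{(i)}-S\|$. Suppose that $\gamma^{(0)}=\max\Theta$ and that, for all $i\ge0$, $$\gamma^{(i+1)}=\begin{cases}\theta_i&\text{if }\alpha_i\delta_i<\theta_i,\\ \gamma^{(i)}&\text{otherwise,}\end{cases}\qquad \theta_i=\max\{z\in\Theta: z<\gamma^{(i)}\}.$$ Then $\gamma^\ast=0$ and $\liminf_{i\to\infty}\delta_i=0$; moreover there are a subsequence $(X^{(i_k)})_k$ and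 stationary points $S_k\in\mathcal S^\ast_{\gamma^{(i_k)}}$ with $\|S_k-X^{(i_k)}\|\to0$. -/

import Mathlib

open Filter Topology

noncomputable section

/-- Real tensors of size `n 0 × ⋯ × n (d-1)`; the norm is the Frobenius norm. -/
abbrev Tensor {d : ℕ} (n : Fin d → ℕ) : Type :=
  EuclideanSpace ℝ ((μ : Fin d) → Fin (n μ))

/-- Multi-indices for the modes in `J`; there are `n_J = ∏ μ ∈ J, n μ` of them. -/
abbrev MultiIndex {d : ℕ} (n : Fin d → ℕ) (J : Finset (Fin d)) : Type :=
  (μ : {μ : Fin d // μ ∈ J}) → Fin (n μ)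

/-- The matricization `X^{[J]}`: rows are indexed by the modes in `J`, columns by the modes
in the complement of `J`. -/
def matricization {d : ℕ} {n : Fin d → ℕ} (J : Finset (Fin d)) (X : Tensor n) :
    Matrix (MultiIndex n J) (MultiIndex n Jᶜ) ℝ :=
  Matrix.of fun a b => X fun μ =>
    if h : μ ∈ J then a ⟨μ, h⟩ else b ⟨μ, Finset.mem_compl.2 h⟩

/-- The regularized Gram matrix `X^{[J]} (X^{[J]})ᵀ + γ I`. -/
def regGram {d : ℕ} {n : Fin d → ℕ} (γ : ℝ) (X : Tensor n) (J : Finset (Fin d)) :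
    Matrix (MultiIndex n J) (MultiIndex n J) ℝ :=
  matricization J X * (matricization J X).transpose
    + γ • (1 : Matrix (MultiIndex n J) (MultiIndex n J) ℝ)

/-- The objective `f_γ^F(X) = ∑_{J ∈ F} log det (X^{[J]} (X^{[J]})ᵀ + γ I)` for a finite family
`F` of sets of modes, summed with multiplicity. -/
def objective {d : ℕ} {n : Fin d → ℕ} (F : Multiset (Finset (Fin d))) (γ : ℝ) (X : Tensor n) : ℝ :=
  (F.map fun J => Real.log (regGram γ X J).det).sum

/-- The augmented functional
`∑_{J ∈ F} (trace (W^J (X^{[J]} (X^{[J]})ᵀ + γ I)) - log det W^J - n_J)`. -/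
def augmented {d : ℕ} {n : Fin d → ℕ} (F : Multiset (Finset (Fin d))) (γ : ℝ) (X : Tensor n)
    (W : (J : Finset (Fin d)) → Matrix (MultiIndex n J) (MultiIndex n J) ℝ) : ℝ :=
  (F.map fun J => (W J * regGram γ X J).trace - Real.log (W J).det
    - ((∏ μ ∈ J, n μ : ℕ) : ℝ)).sum

/-- The weights `W^J_{γ,X} = (X^{[J]} (X^{[J]})ᵀ + γ I)⁻¹`. -/
def weight {d : ℕ} {n : Fin d → ℕ} (γ : ℝ) (X : Tensor n) (J : Finset (Fin d)) :
    Matrix (MultiIndex n J) (MultiIndex n J) ℝ :=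
  (regGram γ X J)⁻¹

/-- The family `K^S`: each member of `S` is replaced by its complement. It is a family with
multiplicity, so that no member is lost if `K` holds both a set and its complement. -/
def switched {d : ℕ} (K S : Finset (Finset (Fin d))) : Multiset (Finset (Fin d)) :=
  (K \ S).val + S.val.map fun J => Jᶜ

/-- `X` is the weighted least squares update: it minimizes the augmented functional with the
weights `W` held fixed, subject to `L X = y`. -/
def IsUpdate {d : ℕ} {n : Fin d → ℕ} {l : ℕ} (L : Tensor n →ₗ[ℝ] (Fin l → ℝ)) (y : Fin l → ℝ)
    (F : Multiset (Finset (Fin d))) (γ : ℝ)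
    (W : (J : Finset (Fin d)) → Matrix (MultiIndex n J) (MultiIndex n J) ℝ)
    (X : Tensor n) : Prop :=
  L X = y ∧ ∀ Z : Tensor n, L Z = y → augmented F γ X W ≤ augmented F γ Z W

/-- `X` is a run of iteratively reweighted least squares with switching weights, for the
switching sets `S i ⊆ K` and the weakly decreasing positive parameters `γ i`. -/
structure IsIRLSRun {d : ℕ} {n : Fin d → ℕ} {l : ℕ} (K : Finset (Finset (Fin d)))
    (L : Tensor n →ₗ[ℝ] (Fin l → ℝ)) (y : Fin l → ℝ)
    (S : ℕ → Finset (Finset (Fin d))) (γ : ℕ → ℝ) (X : ℕ → Tensor n) : Prop where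
  switch_subset : ∀ i, S i ⊆ K
  gamma_pos : ∀ i, 0 < γ i
  gamma_antitone : Antitone γ
  start : L (X 0) = y
  step : ∀ i, IsUpdate L y (switched K (S i)) (γ i) (weight (γ i) (X i)) (X (i + 1))

/-- The stationary points of `f_γ^F` restricted to the affine space `L⁻¹(y)`: the points `X` of
that space at which the derivative of `H ↦ f_γ^F (X + H)`, for `H` in the kernel of `L`, exists
and vanishes. -/
def stationaryPoints {d : ℕ} {n : Fin d → ℕ} {l : ℕ} (F : Multiset (Finset (Fin d)))
    (L : Tensor n →ₗ[ℝ] (Fin l → ℝ)) (y : Fin l → ℝ) (γ : ℝ) : Set (Tensor n) :=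
  {X | L X = y ∧
    HasFDerivAt (fun H : LinearMap.ker L => objective F γ (X + (H : Tensor n)))
      (0 : LinearMap.ker L →L[ℝ] ℝ) 0}

end

/-! ### Determinant and trace inequalities for positive definite matrices -/

section Matrices

open Matrix

variable {m k : Type*} [Fintype m] [Fintype k]

/-! The iteration is majorization–minimization. For positive definite `W`, `G` one has log det G ≤
tr(WG) − log det W − m, where m is the matrix size, with equality at W = G⁻¹. So the augmented
functional lies above the objective and touches it at the current iterate, and minimizing it lowers
the objective (`objective_le_augmented`, `augmented_weight_self`). Sylvester's determinant identity
shows that passing from J to its complement changes log det by a constant independent of X, so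
descent for the switched family in use is descent for every switched family; lowering γ only helps.
This is (i). The bound log det ≥ n_J log γ + log(1 + ‖X‖²/γ) makes the objective coercive, whence
(ii).

With the weights fixed, the augmented functional is quadratic in X, so comparing the minimizer with
a midpoint bounds the weighted square of the step by the decrease of the objective. On bounded
iterates the weighted form controls the Frobenius norm, so the steps tend to 0. In the limit an
accumulation point is an update of itself, and the touching majorant makes it stationary. This is
(iii).

For (iv), if γ dropped only finitely often it would be eventually constant and positive; by (iii) δ
would be arbitrarily small infinitely often, forcing another drop. Hence γ drops infinitely often,
its limit is an accumulation point of Θ, and at the drops δ is at most γ / inf α. -/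

theorem Matrix.trace_mul_transpose_self (M : Matrix m k ℝ) :
    (M * Mᵀ).trace = ∑ i, ∑ j, M i j ^ 2 := by
  simp [Matrix.trace, Matrix.mul_apply, sq]

/-- Submultiplicativity of the Frobenius norm, squared: Cauchy–Schwarz in each entry. -/
theorem Matrix.trace_mul_transpose_self_mul_le (N : Matrix m m ℝ) (C : Matrix m k ℝ) :
    ((N * C) * (N * C)ᵀ).trace ≤ (N * Nᵀ).trace * (C * Cᵀ).trace := by
  simp only [Matrix.trace_mul_transpose_self, Matrix.mul_apply]
  rw [Finset.sum_mul]
  refine Finset.sum_le_sum fun i _ => ?_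
  rw [Finset.sum_comm (s := Finset.univ (α := m)), Finset.mul_sum]
  exact Finset.sum_le_sum fun j _ => Finset.sum_mul_sq_le_sq_mul_sq _ _ _

variable [DecidableEq m]

theorem Matrix.IsHermitian.det_add_smul_one {B : Matrix m m ℝ} (hB : B.IsHermitian) (γ : ℝ) :
    (B + γ • (1 : Matrix m m ℝ)).det = ∏ i, (hB.eigenvalues i + γ) := by
  have h := congrArg (Polynomial.eval (-γ)) hB.charpoly_eq
  rw [Matrix.eval_charpoly, Polynomial.eval_prod] at h
  have e : B + γ • (1 : Matrix m m ℝ) = -(Matrix.scalar m (-γ) - B) := by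
    ext i j
    by_cases hij : i = j
    · subst hij; simp
    · simp [hij]
  rw [e, Matrix.det_neg, h, Fintype.card, ← Finset.prod_const, ← Finset.prod_mul_distrib]
  refine Finset.prod_congr rfl fun i _ => ?_
  simp

theorem Matrix.PosSemidef.det_add_smul_one_mono {B : Matrix m m ℝ} (hB : B.PosSemidef)
    {γ γ' : ℝ} (hγ : 0 ≤ γ) (h : γ ≤ γ') :
    (B + γ • (1 : Matrix m m ℝ)).det ≤ (B + γ' • (1 : Matrix m m ℝ)).det := by
  rw [hB.1.det_add_smul_one, hB.1.det_add_smul_one]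
  refine Finset.prod_le_prod (fun i _ => ?_) fun i _ => ?_
  · have := hB.eigenvalues_nonneg i; positivity
  · gcongr

theorem Finset.one_add_sum_le_prod_one_add_of_nonneg {ι : Type*} (s : Finset ι) (x : ι → ℝ)
    (hx : ∀ i, 0 ≤ x i) : 1 + ∑ i ∈ s, x i ≤ ∏ i ∈ s, (1 + x i) := by
  classical
  induction s using Finset.induction_on with
  | empty => simp
  | insert a s ha ih =>
    rw [Finset.sum_insert ha, Finset.prod_insert ha]
    have h1 := Finset.sum_nonneg (s := s) fun i _ => hx i
    nlinarith [hx a, mul_nonneg (hx a) h1, mul_le_mul_of_nonneg_left ih (hx a)]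

/-- Only the terms of degree at most one in the expansion of ∏ (1 + λᵢ/γ) are kept. The trace
becomes ‖X‖², which is the source of coercivity. -/
theorem Matrix.PosSemidef.le_det_add_smul_one {B : Matrix m m ℝ} (hB : B.PosSemidef)
    {γ : ℝ} (hγ : 0 < γ) :
    γ ^ Fintype.card m * (1 + B.trace / γ) ≤ (B + γ • (1 : Matrix m m ℝ)).det := by
  have h := Finset.one_add_sum_le_prod_one_add_of_nonneg Finset.univ
    (fun i => hB.1.eigenvalues i / γ) fun i => div_nonneg (hB.eigenvalues_nonneg i) hγ.le
  rw [hB.1.det_add_smul_one, hB.1.trace_eq_sum_eigenvalues, Finset.sum_div]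
  calc _ ≤ γ ^ Fintype.card m * ∏ i, (1 + hB.1.eigenvalues i / γ) := by
        gcongr; simpa using h
    _ = _ := by
        rw [Fintype.card, ← Finset.prod_const, ← Finset.prod_mul_distrib]
        refine Finset.prod_congr rfl fun i _ => ?_
        field_simp
        ring

theorem Matrix.posDef_mul_transpose_add_smul_one (A : Matrix m k ℝ) {γ : ℝ} (hγ : 0 < γ) :
    (A * Aᵀ + γ • (1 : Matrix m m ℝ)).PosDef := by
  have h := Matrix.posSemidef_self_mul_conjTranspose A
  rw [Matrix.conjTranspose_eq_transpose_of_trivial] at h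
  exact Matrix.PosDef.posSemidef_add h (Matrix.PosDef.one.smul hγ)

/-- Sylvester's identity det(1 + AB) = det(1 + BA), rescaled by γ. -/
theorem Matrix.det_mul_transpose_add_smul_one [DecidableEq k] (A : Matrix m k ℝ) {γ : ℝ} (hγ : 0 < γ) :
    (A * Aᵀ + γ • (1 : Matrix m m ℝ)).det * γ ^ Fintype.card k =
      (Aᵀ * A + γ • (1 : Matrix k k ℝ)).det * γ ^ Fintype.card m := by
  have e1 : A * Aᵀ + γ • (1 : Matrix m m ℝ) = γ • (1 + (γ⁻¹ • A) * Aᵀ) := by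
    rw [smul_add, Matrix.smul_mul, smul_smul, mul_inv_cancel₀ hγ.ne', one_smul, add_comm]
  have e2 : Aᵀ * A + γ • (1 : Matrix k k ℝ) = γ • (1 + Aᵀ * (γ⁻¹ • A)) := by
    rw [smul_add, Matrix.mul_smul, smul_smul, mul_inv_cancel₀ hγ.ne', one_smul, add_comm]
  rw [e1, e2, Matrix.det_smul, Matrix.det_smul, Matrix.det_one_add_mul_comm]
  ring

theorem Matrix.PosDef.exists_eq_transpose_mul_self {G : Matrix m m ℝ} (hG : G.PosDef) :
    ∃ R : Matrix m m ℝ, IsUnit R.det ∧ G = Rᵀ * R := by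
  obtain ⟨R, hR⟩ : ∃ R : Matrix m m ℝ, G = Rᵀ * R := by
    open scoped MatrixOrder in
    obtain ⟨R, hR⟩ := CStarAlgebra.nonneg_iff_eq_star_mul_self.1
      (Matrix.nonneg_iff_posSemidef.2 hG.posSemidef)
    exact ⟨R, by simpa [Matrix.star_eq_conjTranspose] using hR⟩
  refine ⟨R, ?_, hR⟩
  have := hG.det_pos
  rw [hR, Matrix.det_mul, Matrix.det_transpose] at this
  exact isUnit_iff_ne_zero.2 fun h => by simp [h] at this

/-- Sum of log λ ≤ λ − 1 over the eigenvalues. -/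
theorem Matrix.PosDef.card_add_log_det_le_trace {G : Matrix m m ℝ} (hG : G.PosDef) :
    Fintype.card m + Real.log G.det ≤ G.trace := by
  have h1 : G.det = ∏ i, hG.1.eigenvalues i := by simpa using hG.1.det_eq_prod_eigenvalues
  have h2 : G.trace = ∑ i, hG.1.eigenvalues i := by simpa using hG.1.trace_eq_sum_eigenvalues
  rw [h1, h2, Real.log_prod fun i _ => (hG.eigenvalues_pos i).ne']
  have : (Fintype.card m : ℝ) = ∑ _i : m, (1 : ℝ) := by simp
  rw [this, ← Finset.sum_add_distrib]
  refine Finset.sum_le_sum fun i _ => ?_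
  linarith [Real.log_le_sub_one_of_pos (hG.eigenvalues_pos i)]

/-- WG need not be symmetric, so W is factored as RᵀR and the previous bound is applied to RGRᵀ,
which has the determinant and trace of WG. -/
theorem Matrix.PosDef.log_det_le_trace_mul {W G : Matrix m m ℝ} (hW : W.PosDef) (hG : G.PosDef) :
    Real.log G.det ≤ (W * G).trace - Real.log W.det - Fintype.card m := by
  obtain ⟨R, hR, rfl⟩ := hW.exists_eq_transpose_mul_self
  have hP : (R * G * Rᵀ).PosDef := by
    have := hG.mul_mul_conjTranspose_same (B := R)
      (Matrix.vecMul_injective_of_isUnit ((Matrix.isUnit_iff_isUnit_det R).2 hR))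
    simpa using this
  have h := hP.card_add_log_det_le_trace
  have e1 : (R * G * Rᵀ).det = (Rᵀ * R).det * G.det := by
    simp only [Matrix.det_mul]; ring
  rw [e1, Real.log_mul hW.det_pos.ne' hG.det_pos.ne', Matrix.trace_mul_comm, ← Matrix.mul_assoc] at h
  linarith

/-- With G = RᵀR and B = RᵀC this is submultiplicativity of the Frobenius norm. The trace of G
serves as a bound for its largest eigenvalue. -/
theorem Matrix.PosDef.trace_mul_transpose_le {G : Matrix m m ℝ} (hG : G.PosDef)
    (B : Matrix m k ℝ) : (B * Bᵀ).trace ≤ G.trace * (G⁻¹ * (B * Bᵀ)).trace := by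
  obtain ⟨R, hR, rfl⟩ := hG.exists_eq_transpose_mul_self
  have hRt : IsUnit Rᵀ.det := by rwa [Matrix.det_transpose]
  set C := (Rᵀ)⁻¹ * B with hC
  have hB : B = Rᵀ * C := by rw [hC, Matrix.mul_nonsing_inv_cancel_left _ _ hRt]
  have e : ((Rᵀ * R)⁻¹ * (B * Bᵀ)).trace = (C * Cᵀ).trace := by
    rw [hC, Matrix.mul_inv_rev, Matrix.transpose_mul, ← Matrix.transpose_nonsing_inv,
      Matrix.transpose_transpose, Matrix.mul_assoc, Matrix.trace_mul_comm]
    simp only [Matrix.mul_assoc]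
  rw [e]
  have h := Matrix.trace_mul_transpose_self_mul_le Rᵀ C
  rwa [← hB, Matrix.transpose_transpose] at h

end Matrices

/-! ### Matricizations, coercivity, the majorant and its quadratic part -/

section Tensors

open Matrix

variable {d : ℕ} {n : Fin d → ℕ}

theorem card_multiIndex (J : Finset (Fin d)) :
    Fintype.card (MultiIndex n J) = ∏ μ ∈ J, n μ := by
  rw [Fintype.card_pi]
  simp only [Fintype.card_fin]
  exact Finset.prod_coe_sort J n

theorem matricization_add (J : Finset (Fin d)) (X Y : Tensor n) :
    matricization J (X + Y) = matricization J X + matricization J Y := rfl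

theorem matricization_smul (J : Finset (Fin d)) (t : ℝ) (X : Tensor n) :
    matricization J (t • X) = t • matricization J X := rfl

/-- A multi-index of the tensor, split into its row and column parts. -/
def multiIndexSplit (n : Fin d → ℕ) (J : Finset (Fin d)) :
    ((μ : Fin d) → Fin (n μ)) ≃ MultiIndex n J × MultiIndex n Jᶜ where
  toFun x := (fun μ => x μ, fun μ => x μ)
  invFun p := fun μ =>
    if h : μ ∈ J then p.1 ⟨μ, h⟩ else p.2 ⟨μ, Finset.mem_compl.2 h⟩
  left_inv x := by ext μ; simp
  right_inv p := by
    ext μ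
    · simp [μ.2]
    · simp [Finset.mem_compl.1 μ.2]

theorem trace_matricization_mul_transpose (J : Finset (Fin d)) (X : Tensor n) :
    (matricization J X * (matricization J X)ᵀ).trace = ‖X‖ ^ 2 := by
  rw [Matrix.trace_mul_transpose_self, EuclideanSpace.norm_sq_eq, ← Fintype.sum_prod_type',
    ← (multiIndexSplit n J).sum_comp]
  refine Finset.sum_congr rfl fun x _ => ?_
  rw [Real.norm_eq_abs, sq_abs]
  exact congrArg (fun z => X z ^ 2) ((multiIndexSplit n J).symm_apply_apply x)

theorem trace_regGram (γ : ℝ) (X : Tensor n) (J : Finset (Fin d)) :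
    (regGram γ X J).trace = ‖X‖ ^ 2 + γ * ((∏ μ ∈ J, n μ : ℕ) : ℝ) := by
  rw [regGram, Matrix.trace_add, trace_matricization_mul_transpose, Matrix.trace_smul,
    Matrix.trace_one, card_multiIndex, smul_eq_mul]

theorem posDef_regGram {γ : ℝ} (hγ : 0 < γ) (X : Tensor n) (J : Finset (Fin d)) :
    (regGram γ X J).PosDef :=
  Matrix.posDef_mul_transpose_add_smul_one _ hγ

theorem posSemidef_matricization_mul_transpose (J : Finset (Fin d)) (X : Tensor n) :
    (matricization J X * (matricization J X)ᵀ).PosSemidef := by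
  simpa using Matrix.posSemidef_self_mul_conjTranspose (matricization J X)

theorem log_det_regGram_mono {γ γ' : ℝ} (hγ : 0 < γ) (h : γ ≤ γ') (X : Tensor n)
    (J : Finset (Fin d)) :
    Real.log (regGram γ X J).det ≤ Real.log (regGram γ' X J).det :=
  Real.log_le_log (posDef_regGram hγ X J).det_pos
    ((posSemidef_matricization_mul_transpose J X).det_add_smul_one_mono hγ.le h)

theorem le_log_det_regGram {γ : ℝ} (hγ : 0 < γ) (X : Tensor n) (J : Finset (Fin d)) :
    ((∏ μ ∈ J, n μ : ℕ) : ℝ) * Real.log γ + Real.log (1 + ‖X‖ ^ 2 / γ) ≤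
      Real.log (regGram γ X J).det := by
  have h := (posSemidef_matricization_mul_transpose J X).le_det_add_smul_one hγ
  rw [trace_matricization_mul_transpose, card_multiIndex] at h
  have h2 : (0 : ℝ) < 1 + ‖X‖ ^ 2 / γ := by positivity
  rw [← Real.log_pow, ← Real.log_mul (by positivity) h2.ne']
  exact Real.log_le_log (by positivity) h

/-- The multi-indices for the complement of the complement. -/
def multiIndexComplCompl (n : Fin d → ℕ) (J : Finset (Fin d)) :
    MultiIndex n Jᶜᶜ ≃ MultiIndex n J where
  toFun a := fun μ => a ⟨μ, by simp [μ.2]⟩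
  invFun a := fun μ => a ⟨μ, by simpa using μ.2⟩
  left_inv _ := rfl
  right_inv _ := rfl

/-- The column types for `Jᶜᶜ` and `J` differ, hence the reindexing; it cancels in the Gram matrix.
-/
theorem matricization_compl (J : Finset (Fin d)) (X : Tensor n) :
    matricization Jᶜ X = (matricization J X)ᵀ.submatrix id (multiIndexComplCompl n J) := by
  ext a b
  simp only [matricization, Matrix.of_apply, Matrix.submatrix_apply, Matrix.transpose_apply, id]
  refine congrArg X (funext fun μ => ?_)
  by_cases h : μ ∈ J <;> simp [h, multiIndexComplCompl]

theorem log_det_regGram_compl {γ : ℝ} (hγ : 0 < γ) (X : Tensor n) (J : Finset (Fin d)) :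
    Real.log (regGram γ X Jᶜ).det = Real.log (regGram γ X J).det +
      (((∏ μ ∈ Jᶜ, n μ : ℕ) : ℝ) - ((∏ μ ∈ J, n μ : ℕ) : ℝ)) * Real.log γ := by
  have h := Matrix.det_mul_transpose_add_smul_one (matricization J X) hγ
  have e : regGram γ X Jᶜ = (matricization J X)ᵀ * matricization J X +
      γ • (1 : Matrix (MultiIndex n Jᶜ) (MultiIndex n Jᶜ) ℝ) := by
    rw [regGram, matricization_compl, Matrix.transpose_submatrix, Matrix.transpose_transpose,
      Matrix.submatrix_mul_equiv, Matrix.submatrix_id_id]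
  rw [← e, ← regGram, card_multiIndex, card_multiIndex] at h
  have h' := congrArg Real.log h
  rw [Real.log_mul (posDef_regGram hγ X J).det_pos.ne' (by positivity),
    Real.log_mul (posDef_regGram hγ X Jᶜ).det_pos.ne' (by positivity), Real.log_pow,
    Real.log_pow] at h'
  linarith [h']

theorem sum_map_switched (K T : Finset (Finset (Fin d))) (g : Finset (Fin d) → ℝ) :
    ((switched K T).map g).sum = ∑ J ∈ K \ T, g J + ∑ J ∈ T, g Jᶜ := by
  rw [switched, Multiset.map_add, Multiset.sum_add, Multiset.map_map]
  rfl

theorem sum_map_eq_sdiff_add {K T : Finset (Finset (Fin d))} (hT : T ⊆ K)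
    (g : Finset (Fin d) → ℝ) :
    (K.val.map g).sum = ∑ J ∈ K \ T, g J + ∑ J ∈ T, g J :=
  (Finset.sum_sdiff hT).symm

theorem card_switched {K T : Finset (Finset (Fin d))} (hT : T ⊆ K) :
    (switched K T).card = K.card := by
  simp only [switched, Multiset.card_add, Multiset.card_map, Finset.card_val]
  exact Finset.card_sdiff_add_card_eq_card hT

/-- The constant depends on γ, so it cancels only between two values taken at the same γ. -/
theorem exists_objective_switched_eq {K T : Finset (Finset (Fin d))} (hT : T ⊆ K) {γ : ℝ}
    (hγ : 0 < γ) :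
    ∃ c : ℝ, ∀ X : Tensor n, objective (switched K T) γ X = objective K.val γ X + c := by
  refine ⟨∑ J ∈ T, (((∏ μ ∈ Jᶜ, n μ : ℕ) : ℝ) - ((∏ μ ∈ J, n μ : ℕ) : ℝ)) * Real.log γ,
    fun X => ?_⟩
  rw [objective, objective, sum_map_switched, sum_map_eq_sdiff_add hT, add_assoc,
    ← Finset.sum_add_distrib]
  exact congrArg _ (Finset.sum_congr rfl fun J _ => log_det_regGram_compl hγ X J)

theorem objective_mono (F : Multiset (Finset (Fin d))) {γ γ' : ℝ} (hγ : 0 < γ) (h : γ ≤ γ')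
    (X : Tensor n) : objective F γ X ≤ objective F γ' X :=
  Multiset.sum_map_le_sum_map _ _ fun J _ => log_det_regGram_mono hγ h X J

theorem le_objective (F : Multiset (Finset (Fin d))) {γ γ' : ℝ} (hγ : 0 < γ) (h : γ ≤ γ')
    (X : Tensor n) :
    (F.map fun J => ((∏ μ ∈ J, n μ : ℕ) : ℝ)).sum * Real.log γ
      + F.card * Real.log (1 + ‖X‖ ^ 2 / γ') ≤ objective F γ' X := by
  calc _ = (F.map fun J => ((∏ μ ∈ J, n μ : ℕ) : ℝ) * Real.log γ
            + Real.log (1 + ‖X‖ ^ 2 / γ')).sum := by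
        rw [Multiset.sum_map_add, Multiset.sum_map_mul_right]; simp
    _ ≤ _ := Multiset.sum_map_le_sum_map _ _ fun J _ => by
        refine le_trans ?_ (le_log_det_regGram (hγ.trans_le h) X J)
        have := Real.log_le_log hγ h
        gcongr

/-- The bound involves `γ'` only through its lower and upper bounds `γ` and `γ''`, so it is uniform
along a run. A nonempty family is needed for the term log(1 + ‖X‖²/γ') to occur. -/
theorem norm_le_of_objective_le {F : Multiset (Finset (Fin d))} (hF : F ≠ 0) {γ γ' γ'' c : ℝ}
    (hγ : 0 < γ) (h : γ ≤ γ') (h' : γ' ≤ γ'') {X : Tensor n} (hc : objective F γ' X ≤ c) :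
    ‖X‖ ≤ Real.sqrt (γ'' * Real.exp
      (c - (F.map fun J => ((∏ μ ∈ J, n μ : ℕ) : ℝ)).sum * Real.log γ)) := by
  have h0 := hγ.trans_le h
  have h1 := le_objective F hγ h X
  have h2 : (1 : ℝ) ≤ F.card := by exact_mod_cast Multiset.card_pos.2 hF
  have h3 : 0 ≤ Real.log (1 + ‖X‖ ^ 2 / γ') := Real.log_nonneg (by
    have : 0 ≤ ‖X‖ ^ 2 / γ' := by positivity
    linarith)
  have h4 : Real.log (1 + ‖X‖ ^ 2 / γ') ≤
      c - (F.map fun J => ((∏ μ ∈ J, n μ : ℕ) : ℝ)).sum * Real.log γ := by nlinarith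
  rw [Real.log_le_iff_le_exp (by positivity)] at h4
  refine Real.le_sqrt_of_sq_le ?_
  have h5 : ‖X‖ ^ 2 / γ' ≤ Real.exp
      (c - (F.map fun J => ((∏ μ ∈ J, n μ : ℕ) : ℝ)).sum * Real.log γ) := by linarith
  rw [div_le_iff₀ h0] at h5
  nlinarith [Real.exp_pos (c - (F.map fun J => ((∏ μ ∈ J, n μ : ℕ) : ℝ)).sum * Real.log γ)]

theorem objective_le_augmented (F : Multiset (Finset (Fin d))) {γ γ' : ℝ} (hγ : 0 < γ)
    (hγ' : 0 < γ') (X Y : Tensor n) :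
    objective F γ X ≤ augmented F γ X (weight γ' Y) := by
  refine Multiset.sum_map_le_sum_map _ _ fun J _ => ?_
  rw [← card_multiIndex]
  exact (posDef_regGram hγ' Y J).inv.log_det_le_trace_mul (posDef_regGram hγ X J)

theorem augmented_weight_self (F : Multiset (Finset (Fin d))) {γ : ℝ} (hγ : 0 < γ)
    (X : Tensor n) : augmented F γ X (weight γ X) = objective F γ X := by
  refine congrArg Multiset.sum (Multiset.map_congr rfl fun J _ => ?_)
  have h := posDef_regGram hγ X J
  rw [weight, Matrix.nonsing_inv_mul _ (isUnit_iff_ne_zero.2 h.det_pos.ne'), Matrix.trace_one,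
    card_multiIndex, Matrix.det_nonsing_inv, Ring.inverse_eq_inv', Real.log_inv]
  ring

/-- The quadratic form `X ↦ ∑_{J ∈ F} trace (W^J X^{[J]} (X^{[J]})ᵀ)`. -/
noncomputable def weightedForm (F : Multiset (Finset (Fin d)))
    (W : (J : Finset (Fin d)) → Matrix (MultiIndex n J) (MultiIndex n J) ℝ) (X : Tensor n) : ℝ :=
  (F.map fun J => (W J * (matricization J X * (matricization J X)ᵀ)).trace).sum

theorem augmented_eq_weightedForm_add (F : Multiset (Finset (Fin d))) (γ : ℝ) (X : Tensor n)
    (W : (J : Finset (Fin d)) → Matrix (MultiIndex n J) (MultiIndex n J) ℝ) :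
    augmented F γ X W = weightedForm F W X + augmented F γ 0 W := by
  rw [augmented, weightedForm, augmented, ← Multiset.sum_map_add]
  refine congrArg Multiset.sum (Multiset.map_congr rfl fun J _ => ?_)
  have : matricization J (0 : Tensor n) = 0 := rfl
  simp only [regGram, this, Matrix.mul_add, Matrix.trace_add, Matrix.zero_mul, Matrix.mul_zero,
    Matrix.trace_zero]
  ring

/-- The parallelogram law, which holds for any quadratic form; no symmetry of `W` enters. -/
theorem weightedForm_midpoint (F : Multiset (Finset (Fin d)))
    (W : (J : Finset (Fin d)) → Matrix (MultiIndex n J) (MultiIndex n J) ℝ) (X Y : Tensor n) :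
    4 * weightedForm F W ((1 / 2 : ℝ) • (X + Y)) + weightedForm F W (X - Y) =
      2 * weightedForm F W X + 2 * weightedForm F W Y := by
  simp only [weightedForm, ← Multiset.sum_map_mul_left, ← Multiset.sum_map_add]
  refine congrArg Multiset.sum (Multiset.map_congr rfl fun J _ => ?_)
  have e : matricization J (X - Y) = matricization J X - matricization J Y := rfl
  simp only [e, matricization_add, matricization_smul, Matrix.transpose_smul, Matrix.transpose_add,
    Matrix.transpose_sub, Matrix.mul_add, Matrix.add_mul, Matrix.sub_mul, Matrix.mul_sub,
    Matrix.smul_mul, Matrix.mul_smul, smul_add, Matrix.trace_add, Matrix.trace_sub,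
    Matrix.trace_smul, smul_eq_mul]
  ring

theorem norm_sq_le_trace_mul (J : Finset (Fin d)) {γ : ℝ} (hγ : 0 < γ) (X D : Tensor n) :
    ‖D‖ ^ 2 ≤ (regGram γ X J).trace *
      (weight γ X J * (matricization J D * (matricization J D)ᵀ)).trace := by
  rw [← trace_matricization_mul_transpose J D]
  exact (posDef_regGram hγ X J).trace_mul_transpose_le _

theorem trace_weight_mul_nonneg (J : Finset (Fin d)) {γ : ℝ} (hγ : 0 < γ) (X D : Tensor n) :
    0 ≤ (weight γ X J * (matricization J D * (matricization J D)ᵀ)).trace := by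
  rw [← Matrix.mul_assoc, Matrix.trace_mul_comm, ← Matrix.mul_assoc]
  have := (posDef_regGram hγ X J).inv.posSemidef.conjTranspose_mul_mul_same (matricization J D)
  simpa [weight] using this.trace_nonneg

/-- Each summand already dominates ‖D‖² up to the factor `R`, and there is at least one summand. -/
theorem norm_sq_le_mul_weightedForm {F : Multiset (Finset (Fin d))} (hF : F ≠ 0) {γ R : ℝ}
    (hγ : 0 < γ) (X D : Tensor n) (hR : ∀ J, (regGram γ X J).trace ≤ R) :
    ‖D‖ ^ 2 ≤ R * weightedForm F (weight γ X) D := by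
  have h2 : (1 : ℝ) ≤ F.card := by exact_mod_cast Multiset.card_pos.2 hF
  have key : ∀ J, ‖D‖ ^ 2 ≤
      R * (weight γ X J * (matricization J D * (matricization J D)ᵀ)).trace := by
    intro J
    have h := norm_sq_le_trace_mul J hγ X D
    exact h.trans (mul_le_mul_of_nonneg_right (hR J) (trace_weight_mul_nonneg J hγ X D))
  calc ‖D‖ ^ 2 ≤ F.card * ‖D‖ ^ 2 := by nlinarith [sq_nonneg ‖D‖]
    _ = (F.map fun _ => ‖D‖ ^ 2).sum := by simp
    _ ≤ (F.map fun J =>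
        R * (weight γ X J * (matricization J D * (matricization J D)ᵀ)).trace).sum :=
      Multiset.sum_map_le_sum_map _ _ fun J _ => key J
    _ = _ := by rw [Multiset.sum_map_mul_left, weightedForm]

end Tensors

/-! ### Continuity and differentiability of the functionals -/

section Regularity

open Matrix

variable {d : ℕ} {n : Fin d → ℕ}

theorem continuous_matricization (J : Finset (Fin d)) :
    Continuous fun X : Tensor n => matricization J X :=
  continuous_matrix fun a b => by
    simp only [matricization, Matrix.of_apply]
    fun_prop

theorem continuous_regGram (J : Finset (Fin d)) :
    Continuous fun p : ℝ × Tensor n => regGram p.1 p.2 J := by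
  have h := (continuous_matricization (n := n) J).comp (continuous_snd (X := ℝ))
  exact (h.matrix_mul h.matrix_transpose).add (continuous_fst.smul continuous_const)

theorem differentiable_regGram_apply (γ : ℝ) (J : Finset (Fin d)) (a b : MultiIndex n J) :
    Differentiable ℝ fun X : Tensor n => regGram γ X J a b := by
  simp only [regGram, matricization, Matrix.add_apply, Matrix.mul_apply, Matrix.of_apply,
    Matrix.transpose_apply]
  fun_prop

theorem Matrix.differentiable_det {E m : Type*} [NormedAddCommGroup E] [NormedSpace ℝ E]
    [Fintype m] [DecidableEq m] {A : E → Matrix m m ℝ}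
    (hA : ∀ i j, Differentiable ℝ fun x => A x i j) : Differentiable ℝ fun x => (A x).det := by
  simp only [Matrix.det_apply]
  fun_prop

theorem Multiset.differentiable_sum_map {E ι : Type*} [NormedAddCommGroup E] [NormedSpace ℝ E]
    (F : Multiset ι) {g : ι → E → ℝ} (hg : ∀ i, Differentiable ℝ (g i)) :
    Differentiable ℝ fun x => (F.map fun i => g i x).sum := by
  induction F using Multiset.induction_on with
  | empty => simp
  | cons a s ih =>
    simp only [Multiset.map_cons, Multiset.sum_cons]
    exact (hg a).add ih

theorem differentiable_objective (F : Multiset (Finset (Fin d))) {γ : ℝ} (hγ : 0 < γ) :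
    Differentiable ℝ fun X : Tensor n => objective F γ X :=
  Multiset.differentiable_sum_map F fun J =>
    (Matrix.differentiable_det (differentiable_regGram_apply γ J)).log
      fun X => (posDef_regGram hγ X J).det_pos.ne'

theorem differentiable_augmented (F : Multiset (Finset (Fin d))) (γ : ℝ)
    (W : (J : Finset (Fin d)) → Matrix (MultiIndex n J) (MultiIndex n J) ℝ) :
    Differentiable ℝ fun X : Tensor n => augmented F γ X W := by
  refine Multiset.differentiable_sum_map F fun J => ?_
  have h := differentiable_regGram_apply (n := n) γ J
  simp only [Matrix.trace, Matrix.diag_apply, Matrix.mul_apply]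
  fun_prop

theorem tendsto_regGram {ι : Type*} {l : Filter ι} {g : ι → ℝ} {Y : ι → Tensor n}
    {γ : ℝ} {Y₀ : Tensor n} (hg : Tendsto g l (𝓝 γ)) (hY : Tendsto Y l (𝓝 Y₀))
    (J : Finset (Fin d)) : Tendsto (fun i => regGram (g i) (Y i) J) l (𝓝 (regGram γ Y₀ J)) := by
  have h := (continuous_regGram (n := n) J).tendsto (γ, Y₀)
  exact (h.comp (hg.prodMk_nhds hY)).congr fun i => rfl

theorem Matrix.tendsto_inv {ι m : Type*} [Fintype m] [DecidableEq m] {l : Filter ι}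
    {A : ι → Matrix m m ℝ} {A₀ : Matrix m m ℝ} (hA : Tendsto A l (𝓝 A₀)) (h : A₀.det ≠ 0) :
    Tendsto (fun i => (A i)⁻¹) l (𝓝 A₀⁻¹) := by
  have hd : Tendsto (fun i => (A i).det) l (𝓝 A₀.det) :=
    ((continuous_id.matrix_det).tendsto A₀).comp hA
  have ha : Tendsto (fun i => (A i).adjugate) l (𝓝 A₀.adjugate) :=
    ((continuous_id.matrix_adjugate).tendsto A₀).comp hA
  simp only [Matrix.inv_def, Ring.inverse_eq_inv']
  exact (hd.inv₀ h).smul ha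

theorem Matrix.tendsto_trace_mul {ι m : Type*} [Fintype m] {l : Filter ι}
    {A B : ι → Matrix m m ℝ} {A₀ B₀ : Matrix m m ℝ} (hA : Tendsto A l (𝓝 A₀))
    (hB : Tendsto B l (𝓝 B₀)) :
    Tendsto (fun i => (A i * B i).trace) l (𝓝 (A₀ * B₀).trace) := by
  simp only [Matrix.trace, Matrix.diag_apply, Matrix.mul_apply]
  refine tendsto_finsetSum _ fun i _ => tendsto_finsetSum _ fun j _ => ?_
  exact (((continuous_id.matrix_elem i j).tendsto A₀).comp hA).mul
    (((continuous_id.matrix_elem j i).tendsto B₀).comp hB)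

theorem tendsto_augmented_weight {ι : Type*} {l : Filter ι} {g : ι → ℝ} {Y Z : ι → Tensor n}
    {γ : ℝ} {Y₀ Z₀ : Tensor n} (hγ : 0 < γ) (hg : Tendsto g l (𝓝 γ)) (hY : Tendsto Y l (𝓝 Y₀))
    (hZ : Tendsto Z l (𝓝 Z₀)) (F : Multiset (Finset (Fin d))) :
    Tendsto (fun i => augmented F (g i) (Y i) (weight (g i) (Z i))) l
      (𝓝 (augmented F γ Y₀ (weight γ Z₀))) := by
  unfold augmented
  refine tendsto_multiset_sum F fun J _ => ?_
  have hG := posDef_regGram hγ Z₀ J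
  have hW : Tendsto (fun i => weight (g i) (Z i) J) l (𝓝 (weight γ Z₀ J)) :=
    Matrix.tendsto_inv (tendsto_regGram hg hZ J) hG.det_pos.ne'
  have hd : Tendsto (fun i => (weight (g i) (Z i) J).det) l (𝓝 (weight γ Z₀ J).det) :=
    ((continuous_id.matrix_det).tendsto (weight γ Z₀ J)).comp hW
  exact ((Matrix.tendsto_trace_mul hW (tendsto_regGram hg hY J)).sub
    (hd.log hG.inv.det_pos.ne')).sub tendsto_const_nhds

end Regularity

/-! ### Stationary points: fixed points of the update, and existence -/

section Stationary

variable {d : ℕ} {n : Fin d → ℕ} {l : ℕ} {L : Tensor n →ₗ[ℝ] (Fin l → ℝ)} {y : Fin l → ℝ}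

theorem stationaryPoints_switched {K T : Finset (Finset (Fin d))} (hT : T ⊆ K) {γ : ℝ}
    (hγ : 0 < γ) :
    stationaryPoints (switched K T) L y γ = stationaryPoints K.val L y γ := by
  obtain ⟨c, hc⟩ := exists_objective_switched_eq (n := n) hT hγ
  ext X
  simp only [stationaryPoints, hc, Set.mem_ofPred_eq, hasFDerivAt_add_const_iff]

theorem differentiableAt_comp_ker_add {f : Tensor n → ℝ} (hf : Differentiable ℝ f) (Z : Tensor n) :
    DifferentiableAt ℝ (fun H : LinearMap.ker L => f (Z + (H : Tensor n))) 0 := by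
  have h : Differentiable ℝ fun H : LinearMap.ker L => Z + (H : Tensor n) :=
    (differentiable_const Z).add (LinearMap.ker L).subtypeL.differentiable
  exact (hf.comp h).differentiableAt

/-- Along the kernel of `L`, `Z` minimizes both the majorant and the gap between majorant and
objective. Both derivatives vanish there, hence so does that of the objective. -/
theorem mem_stationaryPoints_of_isUpdate_self (F : Multiset (Finset (Fin d))) {γ : ℝ}
    (hγ : 0 < γ) {Z : Tensor n} (hZ : IsUpdate L y F γ (weight γ Z) Z) :
    Z ∈ stationaryPoints F L y γ := by
  refine ⟨hZ.1, ?_⟩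
  have hf := (differentiableAt_comp_ker_add (L := L)
    (differentiable_objective F hγ) Z).hasFDerivAt
  have hg := (differentiableAt_comp_ker_add (L := L)
    (differentiable_augmented F γ (weight γ Z)) Z).hasFDerivAt
  have hg0 := IsLocalMin.hasFDerivAt_eq_zero (Eventually.of_forall fun H => by
    have h := hZ.2 (Z + (H : Tensor n)) (by rw [map_add, hZ.1, LinearMap.mem_ker.1 H.2, add_zero])
    simpa using h) hg
  have hd0 := IsLocalMin.hasFDerivAt_eq_zero (Eventually.of_forall fun H => by
    have h := objective_le_augmented F hγ hγ (Z + (H : Tensor n)) Z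
    have h' := augmented_weight_self F hγ Z
    simp only [Pi.sub_apply, ZeroMemClass.coe_zero, add_zero]
    linarith) (hg.sub hf)
  rw [hg0, zero_sub, neg_eq_zero] at hd0
  rwa [hd0] at hf

/-- By coercivity the objective has a minimizer on the affine space. This is needed because
`Metric.infDist` to the empty set is 0 by convention, so a small distance alone would yield no
stationary point. -/
theorem stationaryPoints_nonempty {F : Multiset (Finset (Fin d))} (hF : F ≠ 0) {γ : ℝ}
    (hγ : 0 < γ) {X₀ : Tensor n} (hX₀ : L X₀ = y) : (stationaryPoints F L y γ).Nonempty := by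
  have hcont : Continuous fun X : Tensor n => objective F γ X :=
    (differentiable_objective F hγ).continuous
  have hclosed : IsClosed {X : Tensor n | L X = y} :=
    isClosed_eq L.continuous_of_finiteDimensional continuous_const
  obtain ⟨Z, hZ, hmin⟩ := hcont.continuousOn.exists_isMinOn' hclosed hX₀ (by
    obtain ⟨R, hR⟩ : ∃ R : ℝ, ∀ X : Tensor n, objective F γ X ≤ objective F γ X₀ → ‖X‖ ≤ R :=
      ⟨_, fun X hX => norm_le_of_objective_le hF hγ le_rfl le_rfl hX⟩
    refine Filter.mem_inf_of_left (Filter.mem_of_superset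
      (isCompact_closedBall (0 : Tensor n) R).compl_mem_cocompact fun X hX => ?_)
    by_contra hcon
    exact hX (by simpa using hR X (not_le.1 hcon).le))
  refine ⟨Z, hZ, ?_⟩
  have hf := (differentiableAt_comp_ker_add (L := L)
    (differentiable_objective F hγ) Z).hasFDerivAt
  have hf0 := IsLocalMin.hasFDerivAt_eq_zero (Eventually.of_forall fun H => by
    have h := hmin (a := Z + (H : Tensor n))
      (by simpa [LinearMap.mem_ker.1 H.2] using hZ)
    simpa using h) hf
  rwa [hf0] at hf

end Stationary

/-! ### Descent, boundedness, vanishing steps and accumulation points of a run -/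

section Run

variable {d : ℕ} {n : Fin d → ℕ} {l : ℕ} {K : Finset (Finset (Fin d))}
  {L : Tensor n →ₗ[ℝ] (Fin l → ℝ)} {y : Fin l → ℝ} {S : ℕ → Finset (Finset (Fin d))}
  {γ : ℕ → ℝ} {X : ℕ → Tensor n}

/-- Minimality is tested against the midpoint of `X` and `Y`, which is feasible; the parallelogram
law turns this into a quantitative gap. -/
theorem IsUpdate.half_weightedForm_sub_le {F : Multiset (Finset (Fin d))} {γ : ℝ}
    {W : (J : Finset (Fin d)) → Matrix (MultiIndex n J) (MultiIndex n J) ℝ} {X Y : Tensor n}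
    (h : IsUpdate L y F γ W X) (hY : L Y = y) :
    weightedForm F W (X - Y) / 2 ≤ augmented F γ Y W - augmented F γ X W := by
  have h1 := h.2 ((1 / 2 : ℝ) • (X + Y)) (by
    rw [map_smul, map_add, h.1, hY, ← two_smul ℝ y, smul_smul]; norm_num)
  have h2 := weightedForm_midpoint F W X Y
  rw [augmented_eq_weightedForm_add F γ X, augmented_eq_weightedForm_add F γ (_ • _)] at h1
  rw [augmented_eq_weightedForm_add F γ X, augmented_eq_weightedForm_add F γ Y]
  linarith

theorem IsIRLSRun.map_eq (hrun : IsIRLSRun K L y S γ X) (i : ℕ) : L (X i) = y := by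
  cases i with
  | zero => exact hrun.start
  | succ i => exact (hrun.step i).1

/-- Sufficient decrease: the family `T` measuring the descent is independent of the family `S i`
used in the update. -/
theorem IsIRLSRun.half_weightedForm_sub_le (hrun : IsIRLSRun K L y S γ X)
    {T : Finset (Finset (Fin d))} (hT : T ⊆ K) (i : ℕ) :
    weightedForm (switched K (S i)) (weight (γ i) (X i)) (X (i + 1) - X i) / 2 ≤
      objective (switched K T) (γ i) (X i) -
        objective (switched K T) (γ (i + 1)) (X (i + 1)) := by
  have hγ := hrun.gamma_pos
  have h1 := (hrun.step i).half_weightedForm_sub_le (hrun.map_eq i)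
  rw [augmented_weight_self _ (hγ i)] at h1
  have h2 := objective_le_augmented (switched K (S i)) (hγ i) (hγ i) (X (i + 1)) (X i)
  have h3 := objective_mono (switched K T) (hγ (i + 1)) (hrun.gamma_antitone i.le_succ) (X (i + 1))
  -- Both iterates are compared at the same parameter `γ i`, so the switching constants cancel; the
  -- drop to `γ (i + 1)` is covered by `h3`.
  obtain ⟨c, hc⟩ := exists_objective_switched_eq (n := n) (hrun.switch_subset i) (hγ i)
  obtain ⟨c', hc'⟩ := exists_objective_switched_eq (n := n) hT (hγ i)
  rw [hc] at h1 h2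
  rw [hc'] at h3
  rw [hc']
  linarith

theorem weightedForm_weight_nonneg (F : Multiset (Finset (Fin d))) {γ : ℝ} (hγ : 0 < γ)
    (X D : Tensor n) : 0 ≤ weightedForm F (weight γ X) D := by
  refine Multiset.sum_nonneg fun a ha => ?_
  obtain ⟨J, -, rfl⟩ := Multiset.mem_map.1 ha
  exact trace_weight_mul_nonneg J hγ X D

theorem IsIRLSRun.antitone_objective (hrun : IsIRLSRun K L y S γ X)
    {T : Finset (Finset (Fin d))} (hT : T ⊆ K) :
    Antitone fun i => objective (switched K T) (γ i) (X i) :=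
  antitone_nat_of_succ_le fun i => by
    have h1 := hrun.half_weightedForm_sub_le hT i
    have h2 := weightedForm_weight_nonneg (switched K (S i)) (hrun.gamma_pos i) (X i)
      (X (i + 1) - X i)
    linarith

theorem switched_empty (K : Finset (Finset (Fin d))) : switched K ∅ = K.val := by
  simp [switched]

theorem IsIRLSRun.exists_norm_le (hrun : IsIRLSRun K L y S γ X) (hK : K.Nonempty) {γ₀ : ℝ}
    (hγ₀ : 0 < γ₀) (hle : ∀ i, γ₀ ≤ γ i) : ∃ C : ℝ, ∀ i, ‖X i‖ ≤ C := by
  have hF : K.val ≠ 0 := by simpa [Finset.val_eq_zero] using hK.ne_empty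
  refine ⟨_, fun i => norm_le_of_objective_le hF hγ₀ (hle i)
    (hrun.gamma_antitone (Nat.zero_le i)) (c := objective K.val (γ 0) (X 0)) ?_⟩
  simpa only [switched_empty] using
    hrun.antitone_objective (Finset.empty_subset K) (Nat.zero_le i)

theorem IsIRLSRun.exists_le_objective (hrun : IsIRLSRun K L y S γ X) {γ₀ : ℝ}
    (hγ₀ : 0 < γ₀) (hle : ∀ i, γ₀ ≤ γ i) (F : Multiset (Finset (Fin d))) :
    ∃ C : ℝ, ∀ i, C ≤ objective F (γ i) (X i) := by
  refine ⟨(F.map fun J => ((∏ μ ∈ J, n μ : ℕ) : ℝ)).sum * Real.log γ₀,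
    fun i => le_trans ?_ (le_objective F hγ₀ (hle i) (X i))⟩
  refine le_add_of_nonneg_right (mul_nonneg (Nat.cast_nonneg _) (Real.log_nonneg ?_))
  have := hrun.gamma_pos i
  have : 0 ≤ ‖X i‖ ^ 2 / γ i := by positivity
  linarith

theorem IsIRLSRun.exists_abs_objective_le (hrun : IsIRLSRun K L y S γ X) {γ₀ : ℝ}
    (hγ₀ : 0 < γ₀) (hle : ∀ i, γ₀ ≤ γ i) {T : Finset (Finset (Fin d))} (hT : T ⊆ K) :
    ∃ C : ℝ, ∀ i, |objective (switched K T) (γ i) (X i)| ≤ C := by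
  obtain ⟨c, hc⟩ := hrun.exists_le_objective hγ₀ hle (switched K T)
  exact ⟨_, fun i => abs_le_max_abs_abs (hc i) (hrun.antitone_objective hT (Nat.zero_le i))⟩

theorem IsIRLSRun.tendsto_norm_sub (hrun : IsIRLSRun K L y S γ X) (hK : K.Nonempty) {γ₀ : ℝ}
    (hγ₀ : 0 < γ₀) (hle : ∀ i, γ₀ ≤ γ i) :
    Tendsto (fun i => ‖X (i + 1) - X i‖) atTop (𝓝 0) := by
  obtain ⟨C, hC⟩ := hrun.exists_norm_le hK hγ₀ hle
  obtain ⟨c, hc⟩ := hrun.exists_le_objective hγ₀ hle (switched K ∅)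
  set f := fun i => objective (switched K ∅) (γ i) (X i) with hf
  have hlim := tendsto_atTop_ciInf (hrun.antitone_objective (Finset.empty_subset K))
    ⟨c, by rintro _ ⟨i, rfl⟩; exact hc i⟩
  have hdiff : Tendsto (fun i => f i - f (i + 1)) atTop (𝓝 0) := by
    simpa using hlim.sub (hlim.comp (tendsto_add_atTop_nat 1))
  -- Summing the dimensions over all mode sets makes `R` independent of both `i` and `J`.
  set R : ℝ := C ^ 2 + γ 0 * ∑ J : Finset (Fin d), ((∏ μ ∈ J, n μ : ℕ) : ℝ) with hRdef
  have hR : ∀ i J, (regGram (γ i) (X i) J).trace ≤ R := by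
    intro i J
    rw [trace_regGram, hRdef]
    have h1 : ((∏ μ ∈ J, n μ : ℕ) : ℝ) ≤ ∑ J : Finset (Fin d), ((∏ μ ∈ J, n μ : ℕ) : ℝ) :=
      Finset.single_le_sum (f := fun J => ((∏ μ ∈ J, n μ : ℕ) : ℝ))
        (fun _ _ => Nat.cast_nonneg _) (Finset.mem_univ J)
    have h2 := hrun.gamma_antitone (Nat.zero_le i)
    have h3 := (hrun.gamma_pos 0).le
    have h4 := hC i
    gcongr
  have hbound : ∀ i, ‖X (i + 1) - X i‖ ^ 2 ≤ R * (2 * (f i - f (i + 1))) := by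
    intro i
    have hne : switched K (S i) ≠ 0 := by
      rw [← Multiset.card_pos, card_switched (hrun.switch_subset i)]
      exact hK.card_pos
    refine (norm_sq_le_mul_weightedForm hne (hrun.gamma_pos i) (X i) _ (hR i)).trans ?_
    have h := hrun.half_weightedForm_sub_le (Finset.empty_subset K) i
    have hR0 : 0 ≤ R :=
      (posDef_regGram (hrun.gamma_pos i) (X i) ∅).posSemidef.trace_nonneg.trans (hR i ∅)
    refine mul_le_mul_of_nonneg_left ?_ hR0
    simp only [hf]
    linarith
  have hsq : Tendsto (fun i => ‖X (i + 1) - X i‖ ^ 2) atTop (𝓝 0) :=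
    squeeze_zero (fun i => sq_nonneg _) hbound
      (by simpa using (hdiff.const_mul 2).const_mul R)
  simpa using hsq.sqrt

theorem IsIRLSRun.mem_stationaryPoints_of_mapClusterPt (hrun : IsIRLSRun K L y S γ X)
    (hK : K.Nonempty) {γ₀ : ℝ} (hγ₀ : 0 < γ₀) (hlim : Tendsto γ atTop (𝓝 γ₀)) {Z : Tensor n}
    (hZ : MapClusterPt Z atTop X) : Z ∈ stationaryPoints K.val L y γ₀ := by
  have hdiff := hrun.tendsto_norm_sub hK hγ₀ fun i => hrun.gamma_antitone.le_of_tendsto hlim i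
  obtain ⟨U, hU, hUZ⟩ := mapClusterPt_iff_ultrafilter.1 hZ
  -- The steps vanish, so the shifted sequence has the same limit along `U`.
  have hnext : Tendsto (fun i => X (i + 1)) U (𝓝 Z) := by
    have h := hUZ.add ((tendsto_zero_iff_norm_tendsto_zero.2 hdiff).mono_left hU)
    simpa using h
  -- `K` has finitely many subsets, so the ultrafilter selects one switching set that is used on a
  -- member of `U`.
  obtain ⟨T, hT, hTU⟩ := (Ultrafilter.eventually_exists_mem_iff (f := U)
    (P := fun T i => S i = T) K.powerset.finite_toSet).1
    (Eventually.of_forall fun i => ⟨S i, by simpa using hrun.switch_subset i, rfl⟩)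
  have hT : T ⊆ K := by simpa using hT
  rw [← stationaryPoints_switched hT hγ₀]
  have hclosed : IsClosed {X : Tensor n | L X = y} :=
    isClosed_eq L.continuous_of_finiteDimensional continuous_const
  refine mem_stationaryPoints_of_isUpdate_self _ hγ₀
    ⟨hclosed.mem_of_tendsto hUZ (Eventually.of_forall hrun.map_eq), fun Y hY => ?_⟩
  have hg := hlim.mono_left hU
  refine le_of_tendsto_of_tendsto (tendsto_augmented_weight hγ₀ hg hnext hUZ (switched K T))
    (tendsto_augmented_weight hγ₀ hg (tendsto_const_nhds (x := Y)) hUZ (switched K T)) ?_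
  filter_upwards [hTU] with i hi
  have h := (hrun.step i).2 Y hY
  rwa [hi] at h

end Run

/-! ### The adaptive choice of γ -/

section Parameters

variable {d : ℕ} {n : Fin d → ℕ} {l : ℕ} {K : Finset (Finset (Fin d))}
  {L : Tensor n →ₗ[ℝ] (Fin l → ℝ)} {y : Fin l → ℝ} {S : ℕ → Finset (Finset (Fin d))}
  {γ : ℕ → ℝ} {X : ℕ → Tensor n}

theorem IsIRLSRun.frequently_infDist_lt (hrun : IsIRLSRun K L y S γ X) (hK : K.Nonempty)
    {γ₀ : ℝ} (hγ₀ : 0 < γ₀) (hlim : Tendsto γ atTop (𝓝 γ₀)) {ε : ℝ} (hε : 0 < ε) :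
    ∃ᶠ i in atTop, Metric.infDist (X i) (stationaryPoints K.val L y γ₀) < ε := by
  obtain ⟨C, hC⟩ := hrun.exists_norm_le hK hγ₀ fun i => hrun.gamma_antitone.le_of_tendsto hlim i
  obtain ⟨Z, -, hZ⟩ := (isCompact_closedBall (0 : Tensor n) C).exists_mapClusterPt
    (f := atTop) (u := X) (tendsto_principal.2 (Eventually.of_forall fun i => by simpa using hC i))
  have hmem := hrun.mem_stationaryPoints_of_mapClusterPt hK hγ₀ hlim hZ
  exact (hZ.frequently (Metric.ball_mem_nhds Z hε)).mono fun i hi =>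
    (Metric.infDist_le_dist_of_mem hmem).trans_lt hi

theorem IsIRLSRun.frequently_decrease (hrun : IsIRLSRun K L y S γ X) (hK : K.Nonempty)
    {Θ : Set ℝ} {α δ θ : ℕ → ℝ} (hΘ : ∀ z ∈ Θ, 0 < z) (hα : BddAbove (Set.range α))
    (hαpos : ∀ i, 0 < α i)
    (hδ : ∀ i, δ i = Metric.infDist (X i) (stationaryPoints K.val L y (γ i)))
    (hθ : ∀ i, IsGreatest {z | z ∈ Θ ∧ z < γ i} (θ i))
    (hstep : ∀ i, γ (i + 1) = if α i * δ i < θ i then θ i else γ i) :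
    ∃ᶠ i in atTop, α i * δ i < θ i := by
  intro hnot
  obtain ⟨N, hN⟩ := eventually_atTop.1 hnot
  obtain ⟨A, hA⟩ := hα
  have hA : ∀ i, α i ≤ A := fun i => hA ⟨i, rfl⟩
  have hA0 : 0 < A := (hαpos 0).trans_le (hA 0)
  have hconst : ∀ i ≥ N, γ i = γ N := fun i hi => by
    induction i, hi using Nat.le_induction with
    | base => rfl
    | succ i hi ih => rw [hstep, if_neg (hN i hi), ih]
  have hlim : Tendsto γ atTop (𝓝 (γ N)) :=
    tendsto_const_nhds.congr' (eventually_atTop.2 ⟨N, fun i hi => (hconst i hi).symm⟩)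
  have hθpos : 0 < θ N := hΘ _ (hθ N).1.1
  -- With the threshold `θ N / A`, δ below it gives α δ ≤ A δ < θ, contradicting the absence of
  -- drops after `N`.
  obtain ⟨i, hi, hiN⟩ := ((hrun.frequently_infDist_lt hK (hrun.gamma_pos N) hlim
    (div_pos hθpos hA0)).and_eventually (eventually_ge_atTop N)).exists
  rw [← hconst i hiN, ← hδ, lt_div_iff₀ hA0] at hi
  have hθi : θ i = θ N := (hθ i).unique (by rw [hconst i hiN]; exact hθ N)
  refine hN i hiN ?_
  have hδ0 : 0 ≤ δ i := hδ i ▸ Metric.infDist_nonneg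
  show α i * δ i < θ i
  rw [hθi, mul_comm]
  exact (mul_le_mul_of_nonneg_left (hA i) hδ0).trans_lt hi

/-- Strict drops occur beyond every index, so no `γ i` equals the limit, and the values themselves
are points of `Θ` accumulating there. -/
theorem accPt_of_antitone_frequently_lt {γ : ℕ → ℝ} (hγ : Antitone γ) {γ₀ : ℝ}
    (hlim : Tendsto γ atTop (𝓝 γ₀)) {Θ : Set ℝ} (hmem : ∀ i, γ i ∈ Θ)
    (hfreq : ∃ᶠ i in atTop, γ (i + 1) < γ i) : AccPt γ₀ (𝓟 Θ) := by
  rw [accPt_iff_frequently]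
  refine hlim.frequently (Frequently.of_forall fun i => ⟨?_, hmem i⟩)
  obtain ⟨j, hij, hj⟩ := frequently_atTop.1 hfreq i
  exact ((hγ.le_of_tendsto hlim (j + 1)).trans_lt (hj.trans_le (hγ hij))).ne'

theorem liminf_eq_zero_of_subseq {δ : ℕ → ℝ} (hδ : ∀ i, 0 ≤ δ i) {φ : ℕ → ℕ}
    (hφ : Tendsto φ atTop atTop) (h : Tendsto (fun k => δ (φ k)) atTop (𝓝 0)) :
    liminf δ atTop = 0 := by
  rw [liminf_eq]
  exact IsGreatest.csSup_eq ⟨Eventually.of_forall hδ, fun a ha =>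
    ge_of_tendsto h (hφ.eventually ha)⟩

end Parameters

theorem mainTheorem2 {d : ℕ} (n : Fin d → ℕ) {l : ℕ} (hl : l < ∏ μ, n μ)
    (K : Finset (Finset (Fin d))) (hK : K.Nonempty)
    (hKproper : ∀ J ∈ K, J ≠ ∅ ∧ J ≠ Finset.univ)
    (L : Tensor n →ₗ[ℝ] (Fin l → ℝ)) (hL : Function.Surjective L) (y : Fin l → ℝ)
    (S : ℕ → Finset (Finset (Fin d))) (γ : ℕ → ℝ) (X : ℕ → Tensor n)
    (hrun : IsIRLSRun K L y S γ X)
    (γstar : ℝ) (hγstar : Tendsto γ atTop (𝓝 γstar)) :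
    -- (i)
    (∀ T ⊆ K, ∀ i : ℕ,
      objective (switched K T) (γ (i + 1)) (X (i + 1)) ≤ objective (switched K T) (γ i) (X i)) ∧
    -- (ii)
    (0 < γstar →
      (∃ C : ℝ, ∀ i, ‖X i‖ ≤ C) ∧
      ∀ T ⊆ K, ∃ C : ℝ, ∀ i, |objective (switched K T) (γ i) (X i)| ≤ C) ∧
    -- (iii)
    (0 < γstar →
      Tendsto (fun i => ‖X (i + 1) - X i‖) atTop (𝓝 0) ∧
      ∀ Z : Tensor n, MapClusterPt Z atTop X → Z ∈ stationaryPoints K.val L y γstar) ∧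
    -- (iv)
    (∀ (Θ : Set ℝ) (α δ θ : ℕ → ℝ),
      (∀ z ∈ Θ, 0 < z) → Θ.Infinite → BddAbove Θ → IsGLB Θ 0 →
      (∀ z : ℝ, AccPt z (𝓟 Θ) ↔ z = 0) →
      BddAbove (Set.range α) → 0 < ⨅ i, α i →
      (∀ i, δ i = Metric.infDist (X i) (stationaryPoints K.val L y (γ i))) →
      (∀ i, IsGreatest {z | z ∈ Θ ∧ z < γ i} (θ i)) →
      IsGreatest Θ (γ 0) →
      (∀ i, γ (i + 1) = if α i * δ i < θ i then θ i else γ i) →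
      γstar = 0 ∧ liminf δ atTop = 0 ∧
      ∃ φ : ℕ → ℕ, StrictMono φ ∧ ∃ P : ℕ → Tensor n,
        (∀ k, P k ∈ stationaryPoints K.val L y (γ (φ k))) ∧
        Tendsto (fun k => ‖P k - X (φ k)‖) atTop (𝓝 0)) := by
  have hle : ∀ i, γstar ≤ γ i := fun i => hrun.gamma_antitone.le_of_tendsto hγstar i
  refine ⟨fun T hT i => hrun.antitone_objective hT i.le_succ,
    fun hpos => ⟨hrun.exists_norm_le hK hpos hle,
      fun T hT => hrun.exists_abs_objective_le hpos hle hT⟩,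
    fun hpos => ⟨hrun.tendsto_norm_sub hK hpos hle,
      fun Z hZ => hrun.mem_stationaryPoints_of_mapClusterPt hK hpos hγstar hZ⟩, ?_⟩
  intro Θ α δ θ hΘ _ _ _ hacc hα hinf hδ hθ hγ0 hstep
  -- A real infimum over a set unbounded below is 0 by convention, so positivity of the infimum
  -- forces boundedness.
  have hαbdd : BddBelow (Set.range α) := by
    by_contra h
    rw [Real.iInf_of_not_bddBelow h] at hinf
    exact hinf.false
  have hαle : ∀ i, ⨅ i, α i ≤ α i := fun i => ciInf_le hαbdd i
  have hfreq := hrun.frequently_decrease hK hΘ hα (fun i => hinf.trans_le (hαle i)) hδ hθ hstep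
  have hmem : ∀ i, γ i ∈ Θ := fun i => by
    induction i with
    | zero => exact hγ0.1
    | succ i ih =>
      rw [hstep]
      split_ifs
      exacts [(hθ i).1.1, ih]
  have hzero : γstar = 0 := (hacc γstar).1
    (accPt_of_antitone_frequently_lt hrun.gamma_antitone hγstar hmem (hfreq.mono fun i hi => by
      rw [hstep, if_pos hi]; exact (hθ i).1.2))
  subst hzero
  have hδ0 : ∀ i, 0 ≤ δ i := fun i => hδ i ▸ Metric.infDist_nonneg
  obtain ⟨φ, hφ, hφd⟩ := extraction_of_frequently_atTop hfreq
  have hδlim : Tendsto (fun k => δ (φ k)) atTop (𝓝 0) := by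
    -- At a drop, (inf α) δ ≤ α δ < θ < γ, and γ tends to 0.
    refine squeeze_zero (fun k => hδ0 _) (fun k => ?_)
      (by simpa using (hγstar.comp hφ.tendsto_atTop).div_const (⨅ i, α i))
    rw [le_div_iff₀ hinf, mul_comm]
    exact ((mul_le_mul_of_nonneg_right (hαle _) (hδ0 _)).trans_lt (hφd k)).le.trans
      (hθ (φ k)).1.2.le
  refine ⟨rfl, liminf_eq_zero_of_subseq hδ0 hφ.tendsto_atTop hδlim, φ, hφ, ?_⟩
  -- The slack 1/(k + 1) avoids having to show that the infimal distance is attained.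
  have hex : ∀ k : ℕ, ∃ P ∈ stationaryPoints K.val L y (γ (φ k)),
      dist (X (φ k)) P < δ (φ k) + 1 / ((k : ℝ) + 1) := fun k => by
    have hne := stationaryPoints_nonempty (F := K.val)
      (by simpa [Finset.val_eq_zero] using hK.ne_empty) (hrun.gamma_pos (φ k)) hrun.start
    refine (Metric.infDist_lt_iff hne).1 ?_
    rw [← hδ]
    exact lt_add_of_pos_right _ (by positivity)
  choose P hP hPd using hex
  refine ⟨P, hP, squeeze_zero (fun k => norm_nonneg _) (fun k => ?_)
    (by simpa using hδlim.add tendsto_one_div_add_atTop_nhds_zero_nat)⟩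
  rw [norm_sub_rev, ← dist_eq_norm]
  simpa using (hPd k).le
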